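/- Let $\tau$ be a finite nonempty set of proposition symbols, $\mathcal M_n$ the set of all $\tau$-models with domain $\{1,\dots,n\}$ (each assigning to every point the set of symbols true there), and let $I$ index the $t=2^{|\tau|}$ propositional types $\pi_i$ over $\tau$. Formulas of $\mathrm{GMLU}[\tau]$ are built by $$\varphi ::= \lozenge^{\ge k}\chi \mid \square^{<k}\chi \mid \lozenge^{=k}\chi \mid \square^{\neq k}\chi \mid \varphi\wedge\varphi\mid\varphi\vee\varphi ,\qquad \chi ::= \psi\mid\varphi,\qquad \psi ::= p\mid\neg p\mid\psi\wedge\psi\mid\psi\vee\psi ,$$ with $p\in\tau$ and $k\in\mathbb N=\{0,1,2,\dots\}$. Here $\lozenge^{\ge k}\chi$ (resp. $\lozenge^{=k}\chi$) says that at least (resp. exactly) $k$ points of the model satisfy $\chi$, and $\square^{<k}$, $\square^{\neq k}$ are the respective duals (fewer than $k$, resp. not exactly $k$, points fail $\chi$); $\mathfrak M\vDash\varphi$ means that $\varphi$ holds at all points of $\mathfrak M$. The size of a formula is given by: each literal has size $1$; a conjunction or disjunction has the sum of the sizes of its two parts plus $1$; $\lozenge^{\ge k},\square^{<k}$ add $k$,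 and $\lozenge^{=k},\square^{\neq k}$ add $k+1$. $\mathrm{GMLU}_d$ consists of the formulas in which every occurring modality $\lozenge^{\ge k},\square^{<k}$ has $k\le d$ and every occurring modality $\lozenge^{=k},\square^{\neq k}$ has $k+1\le d$. Models are $\equiv_d$-equivalent if they satisfy the same $\mathrm{GMLU}_d$-formulas. For a $\mathrm{GMLU}_d$-definable $M\subseteq\mathcal M_n$, $C(M)$ is the minimum size of a $\mathrm{GMLU}_d$-formula $\varphi$ such that, for all $\mathfrak M\in\mathcal M_n$, $\mathfrak M\vDash\varphi$ iff $\mathfrak M\in M$. A tuple $\overline n=(n_i)_{i\in I}$ of natural numbers is $(n,d)$-admissible if $n_i\le d$ for all $i$, $\sum_i n_i\le n$, and either $n_i=d$ for some $i$ or $\sum_i n_i=n$. Let $M_{\overline n}\subseteq\mathcal M_n$ be the set of models in which each $\pi_i$ is realized exactly $n_i$ times if $n_i<d$, and at least $d$ times if $n_i=d$. Put $c_\tau=2^{|\tau|}(2|\tau|+1)-1$. For $(n,d)$-admissible tuples define: - $\overline n\preceq_\tau\overline n'$ iff $n_i\le n_i'$ for all $i$, and either $\overline n=\overline n'$ or $\sum_i(n_i'-n_i)>c_\tau$;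 - $\overline n\le_s\overline n'$ iff $\overline n=\overline n'$ or $|M_{\overline n}|<|M_{\overline n'}|$; - $\overline n\le_c\overline n'$ iff $\overline n=\overline n'$ or $C(M_{\overline n})<C(M_{\overline n'})$. **Theorem.** For every $\tau$ as above and every $d\in\mathbb N$ there is $n_0$ such that for all $n\ge n_0$ the following hold. 1. For every $(n,d)$-admissible $\overline n$, the set $M_{\overline n}$ is an equivalence class of $\equiv_d$ on $\mathcal M_n$ and is $\mathrm{GMLU}_d$-definable (so $C(M_{\overline n})$ is well defined). 2. On the $(n,d)$-admissible tuples, $\preceq_\tau\ \subseteq\ \le_s\cap\le_c$. 3. If $\overline n$ and $\overline n'$ are distinct $\preceq_\tau$-comparable $(n,d)$-admissible tuples, then $$|M_{\overline n}|<|M_{\overline n'}|\iff C(M_{\overline n})<C(M_{\overline n'}).$$ -/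

import Mathlib

/-- Propositional formulas in negation normal form over the proposition symbols `τ`. -/
inductive PropFormula (τ : Type*) where
  | pos (p : τ) : PropFormula τ
  | neg (p : τ) : PropFormula τ
  | and (ψ₁ ψ₂ : PropFormula τ) : PropFormula τ
  | or (ψ₁ ψ₂ : PropFormula τ) : PropFormula τ

/-- The graded universal modalities: `diaGe k` is "at least `k` points satisfy", `boxLt k` is
"fewer than `k` points fail", `diaEq k` is "exactly `k` points satisfy" and `boxNe k` is
"the number of points that fail is not `k`". -/
inductive Modality where
  | diaGe (k : ℕ) : Modality
  | boxLt (k : ℕ) : Modality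
  | diaEq (k : ℕ) : Modality
  | boxNe (k : ℕ) : Modality

/-- Formulas of graded universal modal logic. Proposition symbols occur only in the scope of a
modality: `baseModal` applies a modality to a propositional formula, `modal` applies one to a
formula of the logic. -/
inductive GMLU (τ : Type*) where
  | baseModal (m : Modality) (ψ : PropFormula τ) : GMLU τ
  | and (φ₁ φ₂ : GMLU τ) : GMLU τ
  | or (φ₁ φ₂ : GMLU τ) : GMLU τ
  | modal (m : Modality) (φ : GMLU τ) : GMLU τ

/-- The contribution of a modality to formula size; it is also its own counting depth. -/
def Modality.weight : Modality → ℕ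
  | .diaGe k => k
  | .boxLt k => k
  | .diaEq k => k + 1
  | .boxNe k => k + 1

def PropFormula.size {τ : Type*} : PropFormula τ → ℕ
  | .pos _ => 1
  | .neg _ => 1
  | .and ψ₁ ψ₂ => ψ₁.size + ψ₂.size + 1
  | .or ψ₁ ψ₂ => ψ₁.size + ψ₂.size + 1

def GMLU.size {τ : Type*} : GMLU τ → ℕ
  | .baseModal m ψ => ψ.size + m.weight
  | .and φ₁ φ₂ => φ₁.size + φ₂.size + 1
  | .or φ₁ φ₂ => φ₁.size + φ₂.size + 1
  | .modal m φ => φ.size + m.weight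

/-- The counting depth: the largest depth of a modality that occurs anywhere in the formula. -/
def GMLU.depth {τ : Type*} : GMLU τ → ℕ
  | .baseModal m _ => m.weight
  | .and φ₁ φ₂ => max φ₁.depth φ₂.depth
  | .or φ₁ φ₂ => max φ₁.depth φ₂.depth
  | .modal m φ => max m.weight φ.depth

/-- A propositional type over `τ`, given by the truth value of each proposition symbol. -/
abbrev PropType (τ : Type*) := τ → Bool

/-- A Kripke model over `τ` with the fixed `n`-element domain `Fin n`: each point is assigned the
propositional type that it realizes. -/
abbrev KModel (τ : Type*) (n : ℕ) := Fin n → PropType τ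

/-- Semantics of the modalities, for a property `P` of points. The boxes are defined as duals. -/
def Modality.Holds {W : Type*} (P : W → Prop) : Modality → Prop
  | .diaGe k => k ≤ {v : W | P v}.ncard
  | .boxLt k => ¬ k ≤ {v : W | ¬ P v}.ncard
  | .diaEq k => {v : W | P v}.ncard = k
  | .boxNe k => ¬ {v : W | ¬ P v}.ncard = k

def PropFormula.Sat {τ : Type*} {n : ℕ} (M : KModel τ n) : PropFormula τ → Fin n → Prop
  | .pos p, w => M w p = true
  | .neg p, w => ¬ M w p = true
  | .and ψ₁ ψ₂, w => ψ₁.Sat M w ∧ ψ₂.Sat M w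
  | .or ψ₁ ψ₂, w => ψ₁.Sat M w ∨ ψ₂.Sat M w

/-- Truth of a formula at a point of a model. -/
def GMLU.Sat {τ : Type*} {n : ℕ} (M : KModel τ n) : GMLU τ → Fin n → Prop
  | .baseModal m ψ, _ => m.Holds (fun v => ψ.Sat M v)
  | .and φ₁ φ₂, w => φ₁.Sat M w ∧ φ₂.Sat M w
  | .or φ₁ φ₂, w => φ₁.Sat M w ∨ φ₂.Sat M w
  | .modal m φ, _ => m.Holds (fun v => φ.Sat M v)

/-- Point-free truth of a formula in a model. -/
def KModel.Models {τ : Type*} {n : ℕ} (M : KModel τ n) (φ : GMLU τ) : Prop :=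
  ∀ w : Fin n, φ.Sat M w

/-- `φ` defines the set `S` of models with domain `Fin n`. -/
def GMLU.Defines {τ : Type*} {n : ℕ} (φ : GMLU τ) (S : Set (KModel τ n)) : Prop :=
  ∀ M : KModel τ n, M.Models φ ↔ M ∈ S

/-- `S` is definable in the fragment of counting depth at most `d`. -/
def DefinableAt {τ : Type*} {n : ℕ} (d : ℕ) (S : Set (KModel τ n)) : Prop :=
  ∃ φ : GMLU τ, φ.depth ≤ d ∧ φ.Defines S

/-- The description complexity of a definable set `S` of models: the minimum size of a formula of
counting depth at most `d` that defines `S`. -/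
noncomputable def descComplexity {τ : Type*} {n : ℕ} (d : ℕ) (S : Set (KModel τ n)) : ℕ :=
  sInf {s : ℕ | ∃ φ : GMLU τ, φ.depth ≤ d ∧ φ.Defines S ∧ φ.size = s}

/-- The models satisfy the same formulas of counting depth at most `d`. -/
def KModel.EquivAt {τ : Type*} {n : ℕ} (d : ℕ) (M N : KModel τ n) : Prop :=
  ∀ φ : GMLU τ, φ.depth ≤ d → (M.Models φ ↔ N.Models φ)

/-- `S` is an equivalence class of `KModel.EquivAt d`. -/
def IsEquivClass {τ : Type*} {n : ℕ} (d : ℕ) (S : Set (KModel τ n)) : Prop :=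
  ∃ M : KModel τ n, S = {N : KModel τ n | KModel.EquivAt d N M}

/-- The number of points of the model `M` that realize the type `π`. -/
noncomputable def KModel.count {τ : Type*} {n : ℕ} (M : KModel τ n) (π : PropType τ) : ℕ :=
  {w : Fin n | M w = π}.ncard

/-- `(n, d)`-admissible tuples. Tuples are indexed by the types themselves. -/
def Admissible {τ : Type*} [Fintype τ] [DecidableEq τ] (n d : ℕ) (a : PropType τ → ℕ) : Prop :=
  (∀ π, a π ≤ d) ∧ ∑ π, a π ≤ n ∧ ((∃ π, a π = d) ∨ ∑ π, a π = n)

/-- The model class of a tuple `a`: the type `π` is realized exactly `a π` times if `a π < d`, and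
at least `d` times if `a π = d`. -/
def modelClass {τ : Type*} (n d : ℕ) (a : PropType τ → ℕ) : Set (KModel τ n) :=
  {M | ∀ π, (a π < d → M.count π = a π) ∧ (a π = d → d ≤ M.count π)}

/-- The constant `2 ^ |τ| * (2 * |τ| + 1) - 1`. -/
def cTau (τ : Type*) [Fintype τ] : ℤ :=
  2 ^ Fintype.card τ * (2 * (Fintype.card τ : ℤ) + 1) - 1

/-- The order on tuples: coordinatewise, and distinct tuples have distance more than `cTau τ`. -/
def TauLE {τ : Type*} [Fintype τ] [DecidableEq τ] (a b : PropType τ → ℕ) : Prop :=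
  (∀ π, a π ≤ b π) ∧ (a = b ∨ cTau τ < ∑ π, ((b π : ℤ) - (a π : ℤ)))

/-- The class-size order: the strict comparison of class sizes with loops added. -/
def SizeLE {τ : Type*} (n d : ℕ) (a b : PropType τ → ℕ) : Prop :=
  a = b ∨ (modelClass n d a).ncard < (modelClass n d b).ncard

/-- The description-complexity order: the strict comparison of description complexities with loops
added. -/
def ComplexityLE {τ : Type*} (n d : ℕ) (a b : PropType τ → ℕ) : Prop :=
  a = b ∨ descComplexity d (modelClass n d a) < descComplexity d (modelClass n d b)

open Finset

/-! Write t = 2^|τ| and take n > 2td. Every admissible tuple then has a coordinate equal to d, and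
for a distinct pair in `TauLE` both class size and description complexity increase strictly.

Class size: raising one coordinate π below d enlarges the class, by double counting the recolourings
of one point to π (`ncard_modelClass_lt_update`). A model of the old class has at least n - td
recolourings that land in the new one, and each result arises from at most td models. Iteration
gives `ncard_modelClass_lt`.

Complexity: the obvious conjunction of counting conditions has size at most Σ a + c_τ. Conversely, a
defining formula must notice when a point of type π is turned into a frequent type σ, and by
`GMLU.exists_visible_types` its size exceeds the total of b over the types where it notices. Hence Σ
b is a lower bound, and a gap larger than c_τ separates the two. If σ is the only maximal type of b,
its summand is dropped from both bounds. -/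

theorem KModel.count_eq_sum {τ : Type*} [DecidableEq (PropType τ)] {n : ℕ} (M : KModel τ n)
    (π : PropType τ) : M.count π = ∑ w : Fin n, if M w = π then 1 else 0 := by
  rw [KModel.count, Set.ncard_eq_toFinset_card', Finset.sum_boole]
  simp

theorem KModel.count_update {τ : Type*} [DecidableEq (PropType τ)] {n : ℕ} (M : KModel τ n)
    (w : Fin n) (π ρ : PropType τ) :
    KModel.count (Function.update M w π) ρ + (if M w = ρ then 1 else 0)
      = M.count ρ + (if π = ρ then 1 else 0) := by
  rw [KModel.count_eq_sum, KModel.count_eq_sum, ← Finset.add_sum_erase _ _ (Finset.mem_univ w),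
    ← Finset.add_sum_erase univ (fun v => if M v = ρ then 1 else 0) (Finset.mem_univ w)]
  have h : ∑ v ∈ univ.erase w, (if Function.update M w π v = ρ then 1 else 0)
      = ∑ v ∈ univ.erase w, (if M v = ρ then 1 else 0) := by
    refine Finset.sum_congr rfl fun v hv => ?_
    rw [Function.update_of_ne (Finset.ne_of_mem_erase hv)]
  rw [h, Function.update_self]
  ring

theorem KModel.sum_count {τ : Type*} [DecidableEq (PropType τ)] {n : ℕ} (M : KModel τ n)
    (X : Finset (PropType τ)) : ∑ ρ ∈ X, M.count ρ = {w : Fin n | M w ∈ X}.ncard := by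
  simp_rw [KModel.count_eq_sum]
  rw [Finset.sum_comm, Set.ncard_eq_toFinset_card', Set.toFinset_ofPred, Finset.card_filter]
  refine Finset.sum_congr rfl fun w _ => ?_
  simp

theorem mem_modelClass_of_count {τ : Type*} {n d : ℕ} {a : PropType τ → ℕ} {σ : PropType τ}
    (hσ : a σ = d) {M : KModel τ n} (h : ∀ ρ, ρ ≠ σ → M.count ρ = a ρ)
    (h' : d ≤ M.count σ) : M ∈ modelClass n d a := by
  intro ρ
  by_cases hρ : ρ = σ
  · subst hρ
    exact ⟨fun h => absurd hσ h.ne, fun _ => h'⟩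
  · exact ⟨fun _ => h ρ hρ, fun h1 => by rw [h ρ hρ, h1]⟩

/-! ### Propositional formulas and types -/

theorem PropFormula.sat_iff_const {τ : Type*} {n : ℕ} (M : KModel τ n) (w : Fin n) (ψ : PropFormula τ) :
    ψ.Sat M w ↔ ψ.Sat (n := 1) (fun _ => M w) 0 := by
  induction ψ with
  | pos p => rfl
  | neg p => rfl
  | and _ _ h1 h2 => exact and_congr h1 h2
  | or _ _ h1 h2 => exact or_congr h1 h2

theorem PropFormula.size_pos {τ : Type*} (ψ : PropFormula τ) : 0 < ψ.size := by
  cases ψ <;> simp [PropFormula.size]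

theorem PropFormula.exists_sat_iff {τ : Type*} [DecidableEq τ] (π : PropType τ) {s : Finset τ} (hs : s.Nonempty) :
    ∃ ψ : PropFormula τ, ψ.size + 1 = 2 * s.card ∧
      ∀ (n : ℕ) (M : KModel τ n) (w : Fin n), ψ.Sat M w ↔ ∀ p ∈ s, M w p = π p := by
  have lit : ∀ p : τ, ∃ ψ : PropFormula τ, ψ.size = 1 ∧
      ∀ (n : ℕ) (M : KModel τ n) (w : Fin n), ψ.Sat M w ↔ M w p = π p := by
    intro p
    cases h : π p with
    | true => exact ⟨.pos p, rfl, fun n M w => Iff.rfl⟩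
    | false => exact ⟨.neg p, rfl, fun n M w => by simp [PropFormula.Sat]⟩
  induction hs using Finset.Nonempty.cons_induction with
  | singleton p =>
    obtain ⟨ψ, h1, h2⟩ := lit p
    exact ⟨ψ, by simp [h1], by simpa using h2⟩
  | cons p s hp _ ih =>
    obtain ⟨ψ, h1, h2⟩ := lit p
    obtain ⟨ψ', h1', h2'⟩ := ih
    refine ⟨.and ψ ψ', ?_, fun n M w => ?_⟩
    · rw [PropFormula.size, Finset.card_cons]
      omega
    · simp [PropFormula.Sat, h2, h2']

/-! ### Models with prescribed type counts -/

section Fintype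

variable {τ : Type*} [Fintype τ] [DecidableEq τ]

theorem KModel.sum_count_univ {n : ℕ} (M : KModel τ n) : ∑ ρ, M.count ρ = n := by
  rw [KModel.sum_count]
  simp

theorem KModel.exists_count_eq {n : ℕ} (c : PropType τ → ℕ) (hc : ∑ ρ, c ρ = n) :
    ∃ M : KModel τ n, ∀ ρ, M.count ρ = c ρ := by
  have e : Fin n ≃ Σ ρ, Fin (c ρ) := Fintype.equivOfCardEq (by simp [hc])
  refine ⟨fun w => (e w).1, fun ρ => ?_⟩
  have h : {w : Fin n | (e w).1 = ρ} = e ⁻¹' (Set.range (Sigma.mk ρ)) := by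
    ext w
    simp only [Set.mem_ofPred_eq, Set.mem_preimage, Set.mem_range]
    constructor
    · rintro rfl
      exact ⟨(e w).2, rfl⟩
    · rintro ⟨y, hy⟩
      rw [← hy]
  rw [KModel.count, h, Set.ncard_preimage_of_injective_subset_range e.injective (by simp),
    ← Set.image_univ, Set.ncard_image_of_injective _ sigma_mk_injective, Set.ncard_univ]
  simp

theorem sum_le_card_mul {d : ℕ} {a : PropType τ → ℕ} (ha : ∀ ρ, a ρ ≤ d)
    (X : Finset (PropType τ)) : ∑ ρ ∈ X, a ρ ≤ 2 ^ Fintype.card τ * d := by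
  calc ∑ ρ ∈ X, a ρ ≤ ∑ ρ, a ρ := Finset.sum_le_sum_of_subset (Finset.subset_univ X)
    _ ≤ ∑ _ρ : PropType τ, d := Finset.sum_le_sum fun ρ _ => ha ρ
    _ = _ := by simp

theorem Admissible.exists_eq {n d : ℕ} {a : PropType τ → ℕ} (h : Admissible n d a)
    (hn : 2 ^ Fintype.card τ * d < n) : ∃ σ, a σ = d := by
  refine h.2.2.resolve_right fun hs => ?_
  have := sum_le_card_mul h.1 univ
  omega

/-- A model realizing all types but `σ` exactly as the tuple `a` says. -/
theorem KModel.exists_count_eq_of_ne {n d : ℕ} {a : PropType τ → ℕ} (ha : ∀ ρ, a ρ ≤ d)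
    (hn : 2 * (2 ^ Fintype.card τ * d) < n) (σ : PropType τ) :
    ∃ M : KModel τ n, (∀ ρ, ρ ≠ σ → M.count ρ = a ρ) ∧ d ≤ M.count σ := by
  have hs := sum_le_card_mul ha (univ.erase σ)
  have hd : d ≤ 2 ^ Fintype.card τ * d := Nat.le_mul_of_pos_left _ (by positivity)
  obtain ⟨M, hM⟩ := KModel.exists_count_eq (n := n)
    (Function.update a σ (n - ∑ ρ ∈ univ.erase σ, a ρ)) (by
      rw [Finset.sum_update_of_mem (Finset.mem_univ σ), Finset.sdiff_singleton_eq_erase]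
      omega)
  refine ⟨M, fun ρ hρ => by rw [hM, Function.update_of_ne hρ], ?_⟩
  rw [hM, Function.update_self]
  omega

theorem modelClass_nonempty {n d : ℕ} {a : PropType τ → ℕ} (ha : ∀ ρ, a ρ ≤ d)
    (hn : 2 * (2 ^ Fintype.card τ * d) < n) {σ : PropType τ} (hσ : a σ = d) :
    (modelClass n d a).Nonempty := by
  obtain ⟨M, h, h'⟩ := KModel.exists_count_eq_of_ne ha hn σ
  exact ⟨M, mem_modelClass_of_count hσ h h'⟩

/-! ### Sizes of model classes -/

/-- Double counting of pairs in which the second model recolours one point of the first to π. It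
suffices to reach the part T of the new class where π occurs exactly `a π + 1` times. -/
theorem ncard_modelClass_lt_update {n d : ℕ} {a : PropType τ → ℕ} (ha : ∀ ρ, a ρ ≤ d)
    (hn : 2 * (2 ^ Fintype.card τ * d) < n) {σ π : PropType τ} (hσ : a σ = d) (hπ : a π < d) :
    (modelClass n d a).ncard
      < (modelClass n d (Function.update a π (a π + 1))).ncard := by
  classical
  set t := 2 ^ Fintype.card τ with ht
  set S : Finset (KModel τ n) := univ.filter (· ∈ modelClass n d a) with hS
  set T : Finset (KModel τ n) := univ.filter
    fun N => N ∈ modelClass n d (Function.update a π (a π + 1)) ∧ N.count π = a π + 1 with hT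
  have hSc : (modelClass n d a).ncard = S.card := by
    rw [Set.ncard_eq_toFinset_card']
    congr 1
    ext M
    simp [hS]
  have hTc : T.card ≤ (modelClass n d (Function.update a π (a π + 1))).ncard := by
    rw [Set.ncard_eq_toFinset_card']
    refine Finset.card_le_card fun N hN => ?_
    simpa using (Finset.mem_filter.1 hN).2.1
  have hSpos : 0 < S.card := by
    rw [← hSc, Set.ncard_pos]
    exact modelClass_nonempty ha hn hσ
  have key := Finset.card_mul_le_card_mul (s := S) (t := T) (m := n - t * d) (n := t * d)
    (fun M N => ∃ w, N = Function.update M w π) ?_ ?_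
  · rw [hSc]
    refine lt_of_lt_of_le ?_ hTc
    by_contra hlt
    have h1 : T.card * (t * d) ≤ S.card * (t * d) := Nat.mul_le_mul_right _ (not_lt.1 hlt)
    -- Here n > 2td is used; since S is nonempty, the surplus of one makes the comparison strict.
    have h2 : S.card * (t * d + 1) ≤ S.card * (n - t * d) := Nat.mul_le_mul_left _ (by omega)
    rw [mul_add] at h2
    omega
  · intro (M : KModel τ n) hM
    have hM : M ∈ modelClass n d a := (Finset.mem_filter.1 hM).2
    -- At most t types occur at most d times, so they cover at most td points. Any other point can
    -- be recoloured while its old type keeps at least d realizations.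
    have hsmall : (univ.filter fun w : Fin n => ¬ d < M.count (M w)).card ≤ t * d := by
      have h1 := M.sum_count (univ.filter fun ρ => ¬ d < M.count ρ)
      rw [Set.ncard_eq_toFinset_card', Set.toFinset_ofPred] at h1
      have h2 : (univ.filter fun w : Fin n => ¬ d < M.count (M w))
          = univ.filter fun w : Fin n => M w ∈ univ.filter fun ρ => ¬ d < M.count ρ := by
        ext w
        simp
      rw [h2, ← h1]
      calc _ ≤ ∑ ρ ∈ univ.filter (fun ρ => ¬ d < M.count ρ), d :=
            Finset.sum_le_sum fun ρ hρ => not_lt.1 (Finset.mem_filter.1 hρ).2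
        _ ≤ t * d := sum_le_card_mul (a := fun _ => d) (fun _ => le_rfl) _
    have hbig : n - t * d ≤ (univ.filter fun w : Fin n => d < M.count (M w)).card := by
      have := Finset.card_filter_add_card_filter_not (s := (univ : Finset (Fin n)))
        (fun w => d < M.count (M w))
      rw [Finset.card_univ, Fintype.card_fin] at this
      omega
    have hMπ : M.count π = a π := (hM π).1 hπ
    refine hbig.trans (Finset.card_le_card_of_injOn (fun w => Function.update M w π) ?_ ?_)
    · intro w hw
      have hw : d < M.count (M w) := by simpa using hw
      have hne : M w ≠ π := by
        intro h
        rw [h] at hw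
        omega
      have haw : a (M w) = d := by
        by_contra h
        have := (hM (M w)).1 (lt_of_le_of_ne (ha _) h)
        have := ha (M w)
        omega
      have hcπ : KModel.count (Function.update M w π) π = a π + 1 := by
        have := M.count_update w π π
        simpa [hne, hMπ] using this
      refine Finset.mem_coe.2 (Finset.mem_filter.2
        ⟨Finset.mem_filter.2 ⟨Finset.mem_univ _, fun ρ => ?_, hcπ⟩, w, rfl⟩)
      by_cases hρ : ρ = π
      · subst hρ
        rw [Function.update_self]
        exact ⟨fun _ => hcπ, fun h => by rw [hcπ, h]⟩
      · rw [Function.update_of_ne hρ]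
        have hc := M.count_update w π ρ
        rw [if_neg (Ne.symm hρ)] at hc
        by_cases hwρ : M w = ρ
        · subst hwρ
          rw [if_pos rfl] at hc
          have hle : d ≤ KModel.count (Function.update M w π) (M w) := by omega
          exact ⟨fun h => absurd haw h.ne, fun _ => hle⟩
        · rw [if_neg hwρ] at hc
          simp only [add_zero] at hc
          rw [hc]
          exact hM ρ
    · intro w hw v hv h
      have hw : d < M.count (M w) := by simpa using hw
      -- If distinct points gave the same recolouring, w would already have type π, which is not
      -- frequent.
      by_contra hne
      have h1 := congrFun h w
      simp only [Function.update_self, Function.update_of_ne hne] at h1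
      rw [← h1] at hw
      omega
  · intro (N : KModel τ n) hN
    have hN : N.count π = a π + 1 := (Finset.mem_filter.1 hN).2.2
    -- A preimage of N is recovered from the recoloured point, one of `a π + 1 ≤ d`, and its old
    -- type, one of t.
    have hsub : Finset.bipartiteBelow (fun M N : KModel τ n => ∃ w, N = Function.update M w π) S N
        ⊆ ((univ.filter fun w => N w = π) ×ˢ (univ : Finset (PropType τ))).image
          fun x => (Function.update N x.1 x.2 : KModel τ n) := by
      intro M hM
      obtain ⟨w, hw⟩ := (Finset.mem_filter.1 hM).2
      refine Finset.mem_image.2 ⟨(w, M w), ?_, ?_⟩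
      · simp [hw]
      · simp [hw]
    refine (Finset.card_le_card hsub).trans (Finset.card_image_le.trans ?_)
    rw [Finset.card_product, Finset.card_filter, ← KModel.count_eq_sum, hN, mul_comm]
    have : (univ : Finset (PropType τ)).card = t := by simp [ht]
    rw [this]
    exact Nat.mul_le_mul_left _ hπ

theorem ncard_modelClass_lt {n d : ℕ} {a b : PropType τ → ℕ} (hb : ∀ ρ, b ρ ≤ d)
    (hn : 2 * (2 ^ Fintype.card τ * d) < n) {σ : PropType τ} (hσ : a σ = d)
    (hab : ∀ ρ, a ρ ≤ b ρ) (hne : a ≠ b) :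
    (modelClass n d a).ncard < (modelClass n d b).ncard := by
  induction h : ∑ ρ, (b ρ - a ρ) generalizing a with
  | zero =>
    refine absurd (funext fun ρ => le_antisymm (hab ρ) ?_) hne
    have := (Finset.sum_eq_zero_iff.1 h) ρ (Finset.mem_univ ρ)
    omega
  | succ k ih =>
    obtain ⟨π, hπ⟩ := Function.ne_iff.1 hne
    have hlt : a π < b π := lt_of_le_of_ne (hab π) hπ
    have hstep := ncard_modelClass_lt_update (fun ρ => (hab ρ).trans (hb ρ)) hn hσ
      (hlt.trans_le (hb π))
    by_cases heq : Function.update a π (a π + 1) = b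
    · rwa [heq] at hstep
    refine hstep.trans (ih ?_ ?_ heq ?_)
    -- The raised coordinate is not σ, since `a σ = d` leaves no room below `b σ`.
    · rw [Function.update_of_ne _, hσ]
      rintro rfl
      have := hb σ
      omega
    · intro ρ
      by_cases hρ : ρ = π
      · subst hρ
        rwa [Function.update_self]
      · rw [Function.update_of_ne hρ]
        exact hab ρ
    · rw [← Finset.add_sum_erase _ _ (Finset.mem_univ π)] at h ⊢
      have h1 : ∑ ρ ∈ univ.erase π, (b ρ - Function.update a π (a π + 1) ρ)
          = ∑ ρ ∈ univ.erase π, (b ρ - a ρ) := by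
        refine Finset.sum_congr rfl fun ρ hρ => ?_
        rw [Function.update_of_ne (Finset.ne_of_mem_erase hρ)]
      rw [h1, Function.update_self]
      omega

/-! ### Defining formulas -/

/-- The conjunction over the types in `s` of the conditions that define `modelClass n d a`. -/
theorem GMLU.exists_sat_iff [Nonempty τ] {d : ℕ} {a : PropType τ → ℕ} (ha : ∀ ρ, a ρ ≤ d)
    {s : Finset (PropType τ)} (hs : s.Nonempty) :
    ∃ φ : GMLU τ, φ.depth ≤ d ∧ φ.size + 1 ≤ ∑ ρ ∈ s, (a ρ + (2 * Fintype.card τ + 1)) ∧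
      ∀ (n : ℕ) (M : KModel τ n) (w : Fin n), φ.Sat M w ↔
        ∀ ρ ∈ s, (a ρ < d → M.count ρ = a ρ) ∧ (a ρ = d → d ≤ M.count ρ) := by
  have atom : ∀ ρ : PropType τ, ∃ φ : GMLU τ, φ.depth ≤ d ∧
      φ.size ≤ a ρ + 2 * Fintype.card τ ∧
      ∀ (n : ℕ) (M : KModel τ n) (w : Fin n), φ.Sat M w ↔
        (a ρ < d → M.count ρ = a ρ) ∧ (a ρ = d → d ≤ M.count ρ) := by
    intro ρ
    obtain ⟨ψ, hψ, hsat⟩ := PropFormula.exists_sat_iff ρ (Finset.univ_nonempty (α := τ))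
    rw [Finset.card_univ] at hψ
    have hset : ∀ (n : ℕ) (M : KModel τ n), {v | ψ.Sat M v}.ncard = M.count ρ := by
      intro n M
      rw [KModel.count]
      congr 1
      ext v
      simp [hsat, funext_iff]
    rcases (ha ρ).lt_or_eq with h | h
    · refine ⟨.baseModal (.diaEq (a ρ)) ψ, h, ?_, fun n M w => ?_⟩
      · simp only [GMLU.size, Modality.weight]
        omega
      · simp [GMLU.Sat, Modality.Holds, hset, h, h.ne]
    · refine ⟨.baseModal (.diaGe d) ψ, le_rfl, ?_, fun n M w => ?_⟩
      · simp only [GMLU.size, Modality.weight]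
        omega
      · simp [GMLU.Sat, Modality.Holds, hset, h]
  induction hs using Finset.Nonempty.cons_induction with
  | singleton ρ =>
    obtain ⟨φ, h1, h2, h3⟩ := atom ρ
    exact ⟨φ, h1, by simp; omega, by simpa using h3⟩
  | cons ρ s hρ _ ih =>
    obtain ⟨φ, h1, h2, h3⟩ := atom ρ
    obtain ⟨φ', h1', h2', h3'⟩ := ih
    refine ⟨.and φ φ', max_le h1 h1', ?_, fun n M w => ?_⟩
    · rw [GMLU.size, Finset.sum_cons]
      omega
    · rw [Finset.forall_mem_cons, GMLU.Sat, h3, h3']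

theorem exists_defines_modelClass [Nonempty τ] {n d : ℕ} (hn : 0 < n) {a : PropType τ → ℕ}
    (ha : ∀ ρ, a ρ ≤ d) {s : Finset (PropType τ)} (hs : s.Nonempty)
    (h : ∀ M : KModel τ n,
      (∀ ρ ∈ s, (a ρ < d → M.count ρ = a ρ) ∧ (a ρ = d → d ≤ M.count ρ)) →
        M ∈ modelClass n d a) :
    ∃ φ : GMLU τ, φ.depth ≤ d ∧ φ.Defines (modelClass n d a) ∧
      φ.size + 1 ≤ ∑ ρ ∈ s, (a ρ + (2 * Fintype.card τ + 1)) := by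
  obtain ⟨φ, h1, h2, h3⟩ := GMLU.exists_sat_iff ha hs
  refine ⟨φ, h1, fun M => ⟨fun hM => h M ((h3 n M ⟨0, hn⟩).1 (hM _)), fun hM w => ?_⟩, h2⟩
  exact (h3 n M w).2 fun ρ _ => hM ρ

theorem descComplexity_add_one_le [Nonempty τ] {n d : ℕ} (hn : 0 < n) {a : PropType τ → ℕ}
    (ha : ∀ ρ, a ρ ≤ d) {s : Finset (PropType τ)} (hs : s.Nonempty)
    (h : ∀ M : KModel τ n,
      (∀ ρ ∈ s, (a ρ < d → M.count ρ = a ρ) ∧ (a ρ = d → d ≤ M.count ρ)) →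
        M ∈ modelClass n d a) :
    descComplexity d (modelClass n d a) + 1
      ≤ ∑ ρ ∈ s, a ρ + 2 ^ Fintype.card τ * (2 * Fintype.card τ + 1) := by
  obtain ⟨φ, h1, h2, h3⟩ := exists_defines_modelClass hn ha hs h
  have hle : descComplexity d (modelClass n d a) ≤ φ.size := Nat.sInf_le ⟨φ, h1, h2, rfl⟩
  rw [Finset.sum_add_distrib] at h3
  have := sum_le_card_mul (d := 2 * Fintype.card τ + 1) (a := fun _ => 2 * Fintype.card τ + 1)
    (fun _ => le_rfl) s
  omega

theorem definableAt_modelClass [Nonempty τ] {n d : ℕ} (hn : 0 < n) {a : PropType τ → ℕ}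
    (ha : ∀ ρ, a ρ ≤ d) : DefinableAt d (modelClass n d a) := by
  obtain ⟨φ, h1, h2, _⟩ := exists_defines_modelClass hn ha Finset.univ_nonempty
    (fun M hM ρ => hM ρ (Finset.mem_univ ρ))
  exact ⟨φ, h1, h2⟩

/-! ### Invariance of formulas -/

/-- The types whose realizations a modality counts when it is applied to `ψ`. -/
noncomputable def Modality.countedTypes (m : Modality) (ψ : PropFormula τ) :
    Finset (PropType τ) := by
  classical
  exact match m with
    | .diaGe _ => univ.filter fun ρ => ψ.Sat (n := 1) (fun _ => ρ) 0
    | .boxLt _ => univ.filter fun ρ => ¬ ψ.Sat (n := 1) (fun _ => ρ) 0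
    | .diaEq _ => univ.filter fun ρ => ψ.Sat (n := 1) (fun _ => ρ) 0
    | .boxNe _ => univ.filter fun ρ => ¬ ψ.Sat (n := 1) (fun _ => ρ) 0

/-- A modality does not distinguish two models in which the counted types are realized equally
often, or in both of them at least as often as its weight. -/
theorem Modality.holds_iff_of_sum_count {n : ℕ} (m : Modality) (ψ : PropFormula τ)
    (M N : KModel τ n)
    (h : ∑ ρ ∈ m.countedTypes ψ, M.count ρ = ∑ ρ ∈ m.countedTypes ψ, N.count ρ ∨
      m.weight ≤ ∑ ρ ∈ m.countedTypes ψ, M.count ρ ∧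
        m.weight ≤ ∑ ρ ∈ m.countedTypes ψ, N.count ρ) :
    m.Holds (fun v => ψ.Sat M v) ↔ m.Holds (fun v => ψ.Sat N v) := by
  simp only [KModel.sum_count] at h
  simp only [PropFormula.sat_iff_const M, PropFormula.sat_iff_const N]
  cases m <;>
    simp only [Modality.Holds, Modality.weight, Modality.countedTypes, Finset.mem_filter,
      Finset.mem_univ, true_and] at h ⊢ <;> omega

/-- If the counted types include one with value d, both counts reach d and hence the weight of the
modality; otherwise all the counts involved are exact and equal. -/
theorem KModel.equivAt_of_mem_modelClass {n d : ℕ} {a : PropType τ → ℕ} (ha : ∀ ρ, a ρ ≤ d)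
    {M N : KModel τ n} (hM : M ∈ modelClass n d a) (hN : N ∈ modelClass n d a) :
    KModel.EquivAt d M N := by
  suffices h : ∀ φ : GMLU τ, φ.depth ≤ d → ∀ w, φ.Sat M w ↔ φ.Sat N w from
    fun φ hφ => forall_congr' (h φ hφ)
  intro φ
  induction φ with
  | baseModal m ψ =>
    intro hm w
    refine m.holds_iff_of_sum_count ψ M N ?_
    by_cases h : ∃ σ ∈ m.countedTypes ψ, a σ = d
    · obtain ⟨σ, hσ, had⟩ := h
      refine Or.inr ⟨?_, ?_⟩
      · exact hm.trans (((hM σ).2 had).trans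
          (Finset.single_le_sum (f := M.count) (fun _ _ => Nat.zero_le _) hσ))
      · exact hm.trans (((hN σ).2 had).trans
          (Finset.single_le_sum (f := N.count) (fun _ _ => Nat.zero_le _) hσ))
    · push Not at h
      refine Or.inl (Finset.sum_congr rfl fun ρ hρ => ?_)
      have hlt := lt_of_le_of_ne (ha ρ) (h ρ hρ)
      rw [(hM ρ).1 hlt, (hN ρ).1 hlt]
  | and _ _ h1 h2 =>
    intro hφ w
    have hφ := max_le_iff.1 hφ
    exact and_congr (h1 hφ.1 w) (h2 hφ.2 w)
  | or _ _ h1 h2 =>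
    intro hφ w
    have hφ := max_le_iff.1 hφ
    exact or_congr (h1 hφ.1 w) (h2 hφ.2 w)
  | modal m φ h =>
    intro hφ w
    have := funext fun v => propext (h (max_le_iff.1 hφ).2 v)
    simp only [GMLU.Sat, this]

theorem isEquivClass_modelClass [Nonempty τ] {n d : ℕ} {a : PropType τ → ℕ} (ha : ∀ ρ, a ρ ≤ d)
    (hn : 2 * (2 ^ Fintype.card τ * d) < n) {σ : PropType τ} (hσ : a σ = d) :
    IsEquivClass d (modelClass n d a) := by
  obtain ⟨M, hM⟩ := modelClass_nonempty ha hn hσ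
  refine ⟨M, Set.ext fun N => ⟨fun hN => KModel.equivAt_of_mem_modelClass ha hN hM, fun hN => ?_⟩⟩
  obtain ⟨φ, hφ, hdef⟩ := definableAt_modelClass (n := n) (by omega) ha
  exact (hdef N).1 ((hN φ hφ).2 ((hdef M).2 hM))

/-! ### Lower bounds on description complexity -/

/-- A formula pays for every type `π` for which it notices that one point of type `π`, in a model
with exactly `b ρ` points of each type `ρ ≠ σ`, is changed to the frequent type `σ`. -/
theorem GMLU.exists_visible_types (n d : ℕ) (b : PropType τ → ℕ) (φ : GMLU τ)
    (hφ : φ.depth ≤ d) :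
    ∃ R : Finset (PropType τ), ∑ ρ ∈ R, b ρ + 1 ≤ φ.size ∧
      ∀ (σ : PropType τ) (M : KModel τ n), (∀ ρ, ρ ≠ σ → M.count ρ = b ρ) → d ≤ M.count σ →
        ∀ u : Fin n, M u ≠ σ → M u ∉ R →
          ∀ w, φ.Sat M w ↔ φ.Sat (Function.update M u σ : KModel τ n) w := by
  induction φ with
  | baseModal m ψ =>
    have hm : m.weight ≤ d := hφ
    have hpos := ψ.size_pos
    -- The choice of R must not depend on σ. If the total of b exceeds the weight, losing one point
    -- keeps the count at or above the weight, so nothing is noticed; otherwise the weight pays for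
    -- all counted types and `ψ.size` for the extra 1.
    refine ⟨if ∑ ρ ∈ m.countedTypes ψ, b ρ ≤ m.weight then m.countedTypes ψ else ∅, ?_, ?_⟩
    · split_ifs with h
      · rw [GMLU.size]
        omega
      · rw [Finset.sum_empty, GMLU.size]
        omega
    intro σ M hM hMσ u hu huR w
    refine m.holds_iff_of_sum_count ψ _ _ ?_
    have hsum : ∑ ρ ∈ m.countedTypes ψ, KModel.count (Function.update M u σ) ρ
        + (if M u ∈ m.countedTypes ψ then 1 else 0)
        = ∑ ρ ∈ m.countedTypes ψ, M.count ρ + (if σ ∈ m.countedTypes ψ then 1 else 0) := by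
      have h := Finset.sum_congr (rfl : m.countedTypes ψ = _)
        fun ρ _ => M.count_update u σ ρ
      simpa [Finset.sum_add_distrib] using h
    -- If σ is counted, the count is at least d before the change and does not drop.
    by_cases hσ : σ ∈ m.countedTypes ψ
    · have h1 : M.count σ ≤ ∑ ρ ∈ m.countedTypes ψ, M.count ρ :=
        Finset.single_le_sum (f := M.count) (fun _ _ => Nat.zero_le _) hσ
      rw [if_pos hσ] at hsum
      split_ifs at hsum <;> omega
    · rw [if_neg hσ] at hsum
      by_cases hmem : M u ∈ m.countedTypes ψ
      · rw [if_pos hmem] at hsum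
        have hgt : ¬ ∑ ρ ∈ m.countedTypes ψ, b ρ ≤ m.weight := by
          intro h
          rw [if_pos h] at huR
          exact huR hmem
        have heq : ∑ ρ ∈ m.countedTypes ψ, M.count ρ = ∑ ρ ∈ m.countedTypes ψ, b ρ :=
          Finset.sum_congr rfl fun ρ hρ => hM ρ (ne_of_mem_of_not_mem hρ hσ)
        omega
      · rw [if_neg hmem] at hsum
        omega
  | and _ _ h1 h2 =>
    have hφ := max_le_iff.1 hφ
    obtain ⟨R, hR, h⟩ := h1 hφ.1
    obtain ⟨R', hR', h'⟩ := h2 hφ.2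
    refine ⟨R ∪ R', ?_, fun σ M hM hMσ u hu huR w => ?_⟩
    · have := Finset.sum_union_inter (s₁ := R) (s₂ := R') (f := b)
      rw [GMLU.size]
      omega
    · rw [Finset.notMem_union] at huR
      exact and_congr (h σ M hM hMσ u hu huR.1 w) (h' σ M hM hMσ u hu huR.2 w)
  | or _ _ h1 h2 =>
    have hφ := max_le_iff.1 hφ
    obtain ⟨R, hR, h⟩ := h1 hφ.1
    obtain ⟨R', hR', h'⟩ := h2 hφ.2
    refine ⟨R ∪ R', ?_, fun σ M hM hMσ u hu huR w => ?_⟩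
    · have := Finset.sum_union_inter (s₁ := R) (s₂ := R') (f := b)
      rw [GMLU.size]
      omega
    · rw [Finset.notMem_union] at huR
      exact or_congr (h σ M hM hMσ u hu huR.1 w) (h' σ M hM hMσ u hu huR.2 w)
  | modal m φ ih =>
    obtain ⟨R, hR, h⟩ := ih (max_le_iff.1 hφ).2
    refine ⟨R, ?_, fun σ M hM hMσ u hu huR w => ?_⟩
    · rw [GMLU.size]
      omega
    · have := funext fun v => propext (h σ M hM hMσ u hu huR v)
      simp only [GMLU.Sat, this]

/-- The description complexity exceeds the total of `b` over any set of types each of which differs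
from some maximal type. -/
theorem sum_lt_descComplexity [Nonempty τ] {n d : ℕ} {b : PropType τ → ℕ} (hb : ∀ ρ, b ρ ≤ d)
    (hn : 2 * (2 ^ Fintype.card τ * d) < n) {s : Finset (PropType τ)}
    (hs : ∀ π ∈ s, ∃ σ, σ ≠ π ∧ b σ = d) :
    ∑ ρ ∈ s, b ρ < descComplexity d (modelClass n d b) := by
  obtain ⟨φ, hφ, hdef, hsize⟩ : ∃ φ : GMLU τ, φ.depth ≤ d ∧ φ.Defines (modelClass n d b) ∧
      φ.size = descComplexity d (modelClass n d b) := by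
    obtain ⟨φ₀, h1, h2⟩ := definableAt_modelClass (n := n) (by omega) hb
    exact Nat.sInf_mem (s := {s | ∃ φ : GMLU τ, φ.depth ≤ d ∧ φ.Defines (modelClass n d b) ∧
      φ.size = s}) ⟨φ₀.size, φ₀, h1, h2, rfl⟩
  obtain ⟨R, hR, hinv⟩ := GMLU.exists_visible_types n d b φ hφ
  rw [← hsize]
  refine lt_of_le_of_lt ?_ (Nat.lt_of_succ_le hR)
  refine Finset.sum_le_sum_of_ne_zero fun π hπ hbπ => ?_
  by_contra hπR
  obtain ⟨σ, hσπ, hσ⟩ := hs π hπ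
  obtain ⟨M, hM, hMσ⟩ := KModel.exists_count_eq_of_ne hb hn σ
  have hMπ := hM π hσπ.symm
  obtain ⟨u, hu⟩ : ∃ u, M u = π := by
    have hne : M.count π ≠ 0 := by rwa [hMπ]
    exact Set.nonempty_of_ncard_ne_zero hne
  have hiff := hinv σ M hM hMσ u (by rw [hu]; exact hσπ.symm) (by rwa [hu])
  -- An unnoticed change would keep the model in the class, though π now occurs only `b π - 1`
  -- times.
  have hmem := (hdef _).1 fun w => (hiff w).1 ((hdef M).2 (mem_modelClass_of_count hσ hM hMσ) w)
  have hc := M.count_update u σ π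
  rw [if_pos hu, if_neg hσπ] at hc
  have := hmem π
  rcases (hb π).lt_or_eq with h | h
  · have := this.1 h
    omega
  · have := this.2 h
    omega

theorem descComplexity_modelClass_lt [Nonempty τ] {n d : ℕ} {a b : PropType τ → ℕ}
    (hb : ∀ ρ, b ρ ≤ d) (hn : 2 * (2 ^ Fintype.card τ * d) < n) {σ : PropType τ} (hσ : a σ = d)
    (hab : ∀ ρ, a ρ ≤ b ρ)
    (hsum : ∑ ρ, a ρ + 2 ^ Fintype.card τ * (2 * Fintype.card τ + 1) ≤ ∑ ρ, b ρ) :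
    descComplexity d (modelClass n d a) < descComplexity d (modelClass n d b) := by
  have ha : ∀ ρ, a ρ ≤ d := fun ρ => (hab ρ).trans (hb ρ)
  have hbσ : b σ = d := le_antisymm (hb σ) (hσ ▸ hab σ)
  -- With a second maximal type, σ itself can also be recoloured, so the lower bound includes every
  -- type.
  by_cases h : ∃ σ', σ' ≠ σ ∧ b σ' = d
  · obtain ⟨σ', hne, hσ'⟩ := h
    have hlow := sum_lt_descComplexity hb hn (s := univ) fun π _ => by
      by_cases hπ : π = σ
      · exact ⟨σ', hπ ▸ hne, hσ'⟩
      · exact ⟨σ, Ne.symm hπ, hbσ⟩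
    have hup := descComplexity_add_one_le (n := n) (by omega) ha Finset.univ_nonempty
      (fun M hM ρ => hM ρ (Finset.mem_univ ρ))
    omega
  · push Not at h
    have hlow := sum_lt_descComplexity hb hn (s := univ.erase σ) fun π hπ =>
      ⟨σ, (Finset.ne_of_mem_erase hπ).symm, hbσ⟩
    have hup := descComplexity_add_one_le (n := n) (by omega) ha (s := univ.erase σ)
      ((Finset.erase_nonempty (Finset.mem_univ σ)).2 Finset.univ_nontrivial)
      -- All other types now have exact counts totalling at most td, so n > 2td forces σ to occur at
      -- least d times: its conjunct is redundant.
      (fun M hM => by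
        have hc : ∀ ρ, ρ ≠ σ → M.count ρ = a ρ := fun ρ hρ =>
          (hM ρ (Finset.mem_erase.2 ⟨hρ, Finset.mem_univ ρ⟩)).1
            (lt_of_le_of_lt (hab ρ) (lt_of_le_of_ne (hb ρ) (h ρ hρ)))
        refine mem_modelClass_of_count hσ hc ?_
        have h1 := M.sum_count_univ
        rw [← Finset.add_sum_erase _ _ (Finset.mem_univ σ),
          Finset.sum_congr (g := fun ρ => a ρ) rfl
            fun ρ hρ => hc ρ (Finset.ne_of_mem_erase hρ)] at h1
        have h2 := sum_le_card_mul ha (univ.erase σ)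
        have h3 : d ≤ 2 ^ Fintype.card τ * d := Nat.le_mul_of_pos_left _ (by positivity)
        omega)
    rw [← Finset.add_sum_erase _ _ (Finset.mem_univ σ),
      ← Finset.add_sum_erase _ b (Finset.mem_univ σ)] at hsum
    omega

end Fintype

/-! ### The main theorem -/

theorem mainTheorem1 {τ : Type*} [Fintype τ] [DecidableEq τ] [Nonempty τ] (d : ℕ) :
    ∃ n₀ : ℕ, ∀ n : ℕ, n₀ ≤ n →
      (∀ a : PropType τ → ℕ, Admissible n d a →
        IsEquivClass d (modelClass n d a) ∧ DefinableAt d (modelClass n d a)) ∧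
      (∀ a b : PropType τ → ℕ, Admissible n d a → Admissible n d b →
        TauLE a b → SizeLE n d a b ∧ ComplexityLE n d a b) ∧
      (∀ a b : PropType τ → ℕ, Admissible n d a → Admissible n d b →
        a ≠ b → (TauLE a b ∨ TauLE b a) →
          ((modelClass n d a).ncard < (modelClass n d b).ncard ↔
            descComplexity d (modelClass n d a) < descComplexity d (modelClass n d b))) := by
  refine ⟨2 * (2 ^ Fintype.card τ * d) + 1, fun n hn => ?_⟩
  have strict : ∀ a b : PropType τ → ℕ, Admissible n d a → Admissible n d b → a ≠ b →
      TauLE a b → (modelClass n d a).ncard < (modelClass n d b).ncard ∧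
        descComplexity d (modelClass n d a) < descComplexity d (modelClass n d b) := by
    rintro a b ha hb hne ⟨hab, h⟩
    obtain ⟨σ, hσ⟩ := ha.exists_eq (by omega)
    have hc := h.resolve_left hne
    refine ⟨ncard_modelClass_lt hb.1 hn hσ hab hne,
      descComplexity_modelClass_lt hb.1 hn hσ hab ?_⟩
    -- Over the integers, a gap strictly above c_τ is a gap of at least t(2|τ| + 1).
    rw [cTau, Finset.sum_sub_distrib] at hc
    zify
    linarith
  refine ⟨fun a ha => ?_, fun a b ha hb hab => ?_, fun a b ha hb hne hab => ?_⟩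
  · obtain ⟨σ, hσ⟩ := ha.exists_eq (by omega)
    exact ⟨isEquivClass_modelClass ha.1 hn hσ, definableAt_modelClass (by omega) ha.1⟩
  · by_cases hne : a = b
    · exact ⟨Or.inl hne, Or.inl hne⟩
    · exact (strict a b ha hb hne hab).imp Or.inr Or.inr
  · rcases hab with hab | hab
    · have h := strict a b ha hb hne hab
      exact iff_of_true h.1 h.2
    · have h := strict b a hb ha hne.symm hab
      exact iff_of_false h.1.not_gt h.2.not_gt
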